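/- \textbf{Setting.} A monotone covering problem consists of a finite set $\mathcal U$ of $n$ elements, a finite set $\mathcal S$ of $m$ resources with costs $c_R\ge 0$, and an augmentation cost $\mathrm{aug}(e,\mathcal R)\ge 0$ for every element $e$ and finite multiset $\mathcal R$ of resources, such that for $\mathcal R\subseteq\mathcal R'$ one has $\mathrm{aug}(e,\mathcal R')\le \mathrm{aug}(e,\mathcal R)\le \mathrm{aug}(e,\mathcal R')+\sum_{R\in\mathcal R'\setminus\mathcal R}c_R$. Let $c(\mathrm{OPT})=\min_{\mathcal R}\big(\sum_{R\in\mathcal R}c_R+\sum_{e\in\mathcal U}\mathrm{aug}(e,\mathcal R)\big)$, let $c(\mathrm{OPT})\le \mathrm{Est}\le 2c(\mathrm{OPT})$, and let $\Delta=\{p\in[0,1]^{\mathcal S}: \langle c,p\rangle\le \mathrm{Est}\}$. Let $\alpha\ge 1$, let $\kappa_e(\mathcal R)$ be an estimate, non-increasing in $\mathcal R$, with $\mathrm{aug}(e,\mathcal R)/\alpha\le\kappa_e(\mathcal R)\le \mathrm{aug}(e,\mathcal R)$, and let $\mathrm{Aug}$ be an algorithm that, given $e$ and $\mathcal R$, outputs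 a multiset $\mathcal A$ of resources with $\sum_{R\in\mathcal A}c_R+\mathrm{aug}(e,\mathcal R\cup\mathcal A)\le\alpha\,\kappa_e(\mathcal R)$ (unions of multisets are taken with multiplicity). \textbf{Algorithm (Mono-OCO).} Let $\mathcal R^1=\emptyset$, $\mathcal U^1=\mathcal U$. For $t=1,\dots,n$, with $\kappa^t_e=\kappa_e(\mathcal R^t)$: an element $e^t$ arrives, uniformly random in $\mathcal U^t$; the algorithm buys $\mathrm{Aug}(e^t,\mathcal R^t)$ and, independently for each $S\in\mathcal S$, buys $S$ with probability $(\kappa^t_{e^t}/\mathrm{Est})\,p^t_S$, which gives $\mathcal R^{t+1}$; its cost in this step is $c(\mathrm{ALG}_t)=\sum_{R\in\mathcal R^{t+1}\setminus\mathcal R^t}c_R+\mathrm{aug}(e^t,\mathcal R^{t+1})$; and $\mathcal U^{t+1}=\mathcal U^t\setminus\{e^t\}$. The vectors $p^t\in\Delta$ are produced by stochastic online mirror descent with parameter $\eta=\tfrac12$: with $D(p,q)=\sum_{i}\frac{c_i}{\mathrm{Est}}\big(p_i\log\frac{p_i}{q_i}-p_i+q_i\big)$, \[ p^1\in\arg\min_{p\in\Delta}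 D\big(p,(\tfrac{\mathrm{Est}}{m c_i})_i\big),\qquad p^{t+1}\in\arg\min_{p\in\Delta}\Big(-\langle G_t,p\rangle+\tfrac1\eta D(p,p^t)\Big), \] where $G_t$ is a supergradient on $\Delta$, at $p^t$, of a function $\mathrm{gain}_{t,e^t}:\Delta\to\mathbb R$; the functions $\mathrm{gain}_{t,e}$ ($e\in\mathcal U^t$) and their supergradients at $p^t$ may depend on the history before time $t$. Let $c(\mathrm{ALG})=\sum_{t=1}^n c(\mathrm{ALG}_t)$, let $\Phi^t=\sum_{e\in\mathcal U^t}\kappa^t_e$, let $\tau$ be the first $t$ with $\Phi^t\le\mathrm{Est}$, and, conditionally on the history before time $t$ and with $\mathbb E_{\omega^t}$ the expectation over the sampling in step $t$, let \[ \mathrm{Rgain}_t=\frac1{|\mathcal U^t|}\cdot\frac1{\Phi^t}\sum_{e,f\in\mathcal U^t}\mathbb E_{\omega^t}\big[\kappa^t_f-\kappa^{t+1}_f\,\big|\,e^t=e\big]. \] \textbf{Lemma.} There is a universal constant $C>0$ such that the following holds for all data as above. Suppose there are functions $\mathrm{gain}_t:\Delta\to\mathbb R_{\ge0}$ (depending on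 the history before time $t$), constants $\gamma\in(0,1]$ and $\beta,\delta>0$, and a vector $p^\star\in\Delta$ such that, for every history of positive probability, \begin{itemize} \item[(A1)] $\gamma\,\mathrm{gain}_t(p^t)\le\mathrm{Rgain}_t$ for every $t\in[n]$ with $\Phi^t>0$; \item[(A2)] $\mathrm{gain}_t(p)=\frac1{|\mathcal U^t|}\sum_{e\in\mathcal U^t}\mathrm{gain}_{t,e}(p)$ for all $t\in[n]$ and $p\in\Delta$ (so that $G_t$ is an unbiased estimate of a supergradient of $\mathrm{gain}_t$ at $p^t$); \item[(A3)] $(G_t)_i\in[0,c_i/\mathrm{Est}]$ for all $t\in[n]$ and $i\in\mathcal S$; \end{itemize} and such that \begin{itemize} \item[(A4)] $\mathbb E\big[\sum_{t<\tau}c(\mathrm{ALG}_t)\big]\le c(\mathrm{OPT})\cdot\Big(\beta\,\mathbb E\big[\sum_{t<\tau}\mathrm{gain}_t(p^\star)\big]+\delta\Big)$. \end{itemize} Then \[ \mathbb E[c(\mathrm{ALG})]\le\Big(C\alpha+\frac{C\beta\log(mn)}{\gamma}+\delta\Big)\cdot c(\mathrm{OPT}). \] (Conventions in degenerate cases: $0\log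 0=0$, terms of $D$ with $c_i=0$ are $0$, fractions with denominator $0$ are $0$, and $\log(mn)=0$ if $mn=0$.) -/

import Mathlib

/-- A monotone covering problem with elements `U` and resources `S`.  `aug e R` is the augmentation
cost of the element `e` when the multiset `R` of resources has already been bought. -/
structure CoveringProblem (U S : Type*) [DecidableEq S] where
  cost : S → ℝ
  aug : U → Multiset S → ℝ
  cost_nonneg : ∀ i, 0 ≤ cost i
  aug_nonneg : ∀ e R, 0 ≤ aug e R
  /-- monotonicity -/
  aug_mono : ∀ e R R', R ≤ R' → aug e R' ≤ aug e R
  /-- minimality -/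
  aug_minimal : ∀ e R R', R ≤ R' → aug e R ≤ aug e R' + ((R' - R).map cost).sum

/-- The sequence of what has happened so far, in chronological order: for each past time step the
element that arrived and the set of resources bought in the sampling line of the algorithm. -/
abbrev History (U S : Type*) := List (U × Finset S)

namespace CoveringProblem

variable {U S : Type*} [DecidableEq S]

/-- Total purchase cost of a multiset of resources. -/
def setCost (P : CoveringProblem U S) (R : Multiset S) : ℝ := (R.map P.cost).sum

/-- The offline optimum `c(OPT)`: the least cost of buying a multiset of resources and then paying
the augmentation costs of all elements. -/
noncomputable def opt [Fintype U] (P : CoveringProblem U S) : ℝ :=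
  ⨅ R : Multiset S, (P.setCost R + ∑ e, P.aug e R)

/-- The feasible set `{p ∈ [0,1]^S | ⟨c, p⟩ ≤ M}`. -/
def simplex [Fintype S] (P : CoveringProblem U S) (M : ℝ) : Set (S → ℝ) :=
  {p | (∀ i, 0 ≤ p i ∧ p i ≤ 1) ∧ ∑ i, P.cost i * p i ≤ M}

/-- The unnormalized Kullback-Leibler divergence `∑ xᵢ log (xᵢ/yᵢ) - xᵢ + yᵢ` of the rescaled vectors
`xᵢ = cᵢ pᵢ / M` and `yᵢ = cᵢ qᵢ / M`. -/
noncomputable def divergence [Fintype S] (P : CoveringProblem U S) (M : ℝ) (p q : S → ℝ) : ℝ :=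
  ∑ i, P.cost i / M * (p i * Real.log (p i / q i) - p i + q i)

/-- The (generally infeasible) reference point `M / (m cᵢ)`, whose rescaling is the uniform vector
`(1/m, …, 1/m)`. -/
noncomputable def uniformPoint [Fintype S] (P : CoveringProblem U S) (M : ℝ) : S → ℝ :=
  fun i => M / (Fintype.card S * P.cost i)

end CoveringProblem

/-- An augmentation cost estimate `kappa` with approximation factor `α`, together with an
augmentation algorithm `backup`, which returns the resources to be bought in order to serve `e`
at total cost at most `α * kappa e R`. -/
structure AugScheme {U S : Type*} [DecidableEq S] (P : CoveringProblem U S) (α : ℝ) where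
  kappa : U → Multiset S → ℝ
  backup : U → Multiset S → Multiset S
  kappa_le : ∀ e R, kappa e R ≤ P.aug e R
  le_kappa : ∀ e R, P.aug e R / α ≤ kappa e R
  kappa_mono : ∀ e R R', R ≤ R' → kappa e R' ≤ kappa e R
  backup_cost : ∀ e R, P.setCost (backup e R) + P.aug e (R + backup e R) ≤ α * kappa e R

/-- A run of stochastic online mirror descent with parameter `1/2` on the feasible set `simplex M`.
`grad h e` is the stochastic gradient received after history `h` when `e` arrives, and `play h` is
the action played after history `h`.  The first action is the Bregman projection of the
(rescaled) uniform vector, and the next action is obtained by a mirror step for gain maximization. -/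
structure MirrorDescent {U S : Type*} [DecidableEq S] [Fintype S]
    (P : CoveringProblem U S) (M : ℝ) where
  grad : History U S → U → S → ℝ
  play : History U S → S → ℝ
  play_mem : ∀ h, play h ∈ P.simplex M
  play_init : IsMinOn (fun p => P.divergence M p (P.uniformPoint M)) (P.simplex M) (play [])
  play_step : ∀ h e W, IsMinOn
    (fun p => -(∑ i, grad h e i * p i) + 1 / (1 / 2 : ℝ) * P.divergence M p (play h))
    (P.simplex M) (play (h ++ [(e, W)]))

/-- Elements that have not arrived during `h`. -/
def remaining {U S : Type*} [Fintype U] [DecidableEq U] (h : History U S) : Finset U :=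
  Finset.univ \ (h.map Prod.fst).toFinset

namespace AugScheme

variable {U S : Type*} [DecidableEq S] {P : CoveringProblem U S} {α : ℝ}

/-- The multiset of resources owned after the history `h`. -/
def owned (A : AugScheme P α) (h : History U S) : Multiset S :=
  h.foldl (fun R x => R + A.backup x.1 R + x.2.val) 0

/-- The cost incurred in the time step `x` that follows the history `h`: newly bought resources,
and the augmentation cost of the arriving element. -/
def stepCost (A : AugScheme P α) (h : History U S) (x : U × Finset S) : ℝ :=
  P.setCost (A.owned (h ++ [x]) - A.owned h) + P.aug x.1 (A.owned (h ++ [x]))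

/-- The potential `Φ`. -/
def potential [Fintype U] [DecidableEq U] (A : AugScheme P α) (h : History U S) : ℝ :=
  ∑ e ∈ remaining h, A.kappa e (A.owned h)

end AugScheme

/-- A full trajectory of the algorithm, with one time step for each element. -/
abbrev Trajectory (U S : Type*) [Fintype U] := Fin (Fintype.card U) → U × Finset S

/-- The history of a trajectory before the (zero-based) time `t`. -/
def past {U S : Type*} [Fintype U] (ω : Trajectory U S) (t : ℕ) : History U S :=
  (List.ofFn ω).take t

namespace MonoOCO

variable {U S : Type*} [Fintype U] [DecidableEq U] [Fintype S] [DecidableEq S]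
  {P : CoveringProblem U S} {α M : ℝ}

/-- Probability that exactly the resources `W` are bought in the sampling line after the history `h`
when `e` arrives: each resource `i` is bought independently with probability
`(kappa e / M) * pᵢ`. -/
noncomputable def sampleProb (A : AugScheme P α) (O : MirrorDescent P M) (h : History U S) (e : U)
    (W : Finset S) : ℝ :=
  ∏ i, if i ∈ W then A.kappa e (A.owned h) / M * O.play h i
    else 1 - A.kappa e (A.owned h) / M * O.play h i

/-- Conditional probability, given the history `h`, of the next time step: the arriving element
is uniform among the remaining ones, and then the resources are sampled. -/
noncomputable def stepProb (A : AugScheme P α) (O : MirrorDescent P M) (h : History U S)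
    (x : U × Finset S) : ℝ :=
  if x.1 ∈ remaining h then 1 / ((remaining h).card : ℝ) * sampleProb A O h x.1 x.2 else 0

/-- Probability of a trajectory. -/
noncomputable def prob (A : AugScheme P α) (O : MirrorDescent P M) (ω : Trajectory U S) : ℝ :=
  ∏ t : Fin (Fintype.card U), stepProb A O (past ω t) (ω t)

/-- Expectation of a random variable on the space of trajectories. -/
noncomputable def expect (A : AugScheme P α) (O : MirrorDescent P M) (f : Trajectory U S → ℝ) : ℝ :=
  ∑ ω, prob A O ω * f ω

/-- Histories that occur with positive probability. -/
inductive Reachable (A : AugScheme P α) (O : MirrorDescent P M) : History U S → Prop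
  | nil : Reachable A O []
  | snoc (h : History U S) (x : U × Finset S) :
      Reachable A O h → 0 < stepProb A O h x → Reachable A O (h ++ [x])

/-- The real gain: the expected relative decrease
`(1/|U^t|) (1/Φ^t) ∑_{e,f ∈ U^t} 𝔼[κ_f^t - κ_f^{t+1} | e^t = e]`. -/
noncomputable def realGain (A : AugScheme P α) (O : MirrorDescent P M) (h : History U S) : ℝ :=
  1 / ((remaining h).card : ℝ) * (1 / A.potential h) *
    ∑ e ∈ remaining h, ∑ f ∈ remaining h, ∑ W : Finset S, sampleProb A O h e W *
      (A.kappa f (A.owned h) - A.kappa f (A.owned (h ++ [(e, W)])))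

/-- The first (zero-based) time at which the potential is at most `M`. -/
noncomputable def stopTime (A : AugScheme P α) (M : ℝ) (ω : Trajectory U S) : ℕ :=
  sInf {t : ℕ | A.potential (past ω t) ≤ M}

/-- The total cost of the algorithm. -/
def totalCost (A : AugScheme P α) (ω : Trajectory U S) : ℝ :=
  ∑ t : Fin (Fintype.card U), A.stepCost (past ω t) (ω t)

/-- The cost of the algorithm in the time steps before the stopping time. -/
noncomputable def costBeforeStop (A : AugScheme P α) (M : ℝ) (ω : Trajectory U S) : ℝ :=
  ∑ t : Fin (Fintype.card U),
    if (t : ℕ) < stopTime A M ω then A.stepCost (past ω t) (ω t) else 0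

/-- The sum of the gains of the fixed vector `q` over the time steps before the stopping time. -/
noncomputable def staticGainBeforeStop (A : AugScheme P α) (M : ℝ)
    (gain : History U S → (S → ℝ) → ℝ) (q : S → ℝ) (ω : Trajectory U S) : ℝ :=
  ∑ t : Fin (Fintype.card U), if (t : ℕ) < stopTime A M ω then gain (past ω t) q else 0

end MonoOCO

/-- `G` is a supergradient at `p` of the function `g` on the set `K`. -/
def IsSupergradientOn {S : Type*} [Fintype S] (K : Set (S → ℝ)) (g : (S → ℝ) → ℝ) (p G : S → ℝ) :
    Prop :=
  ∀ q ∈ K, g q ≤ g p + ∑ i, G i * (q i - p i)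

/-! Write `M` for Est, Φ for the potential, n and m for the numbers of elements and resources. When
e arrives after history h, one step costs at most 2ακ_e in expectation: backup costs ακ_e, sampling
at most κ_e. The departure of e also lowers Φ by at least κ_e.

Once Φ ≤ `M`, Φ itself pays for all further steps, in total at most 2α`M` ≤ 4α c(OPT)
(`expect_totalCost_le`). The earlier cost is bounded by (A4) through the static gains of p⋆, so it
remains to show that their expected sum is O(log(mn)/γ).

This is a regret bound. Since G_t is nonnegative and bounded by the weights of the divergence, a
mirror step loses only a constant factor (`CoveringProblem.mirror_step_inequality`): ⟨G, p⋆⟩ ≤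
(3/2)⟨G, p^t⟩ + 2(D(p⋆, p^t) − D(p⋆, p^{t+1})). The supergradient inequalities at p⋆ and at 0 turn
this into a comparison of gains. On average over e^t, the gain of p^t is at most Rgain_t/γ by (A1),
and Rgain_t is at most the expected relative decrease of Φ, which log(Φ/`M`) + 1 pays for.

Hence (3/2γ)(log(Φ/`M`) + 1) + 2D(p⋆, p^t), set to 0 once Φ ≤ `M`, drops in expectation by at least
the static gain of each step before stopping (`MonoOCO.expect_staticGainBeforeStop_le`). Initially
it is O(log(mn)/γ), because Φ ≤ n·c(OPT) and the first action is projected from the uniform point.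
-/

/-! ### Independent sampling of resources -/

theorem sum_prod_ite_mem {S : Type*} [Fintype S] [DecidableEq S] (a b : S → ℝ) :
    ∑ W : Finset S, ∏ i, (if i ∈ W then a i else b i) = ∏ i, (a i + b i) := by
  rw [Finset.prod_add]
  rw [Finset.powerset_univ]
  refine Finset.sum_congr rfl fun W _ => ?_
  rw [Finset.prod_ite]
  congr 1
  · exact Finset.prod_congr (by ext; simp) fun _ _ => rfl
  · exact Finset.prod_congr (by ext; simp) fun _ _ => rfl

theorem sum_prod_ite_mem_mul_sum {S : Type*} [Fintype S] [DecidableEq S] (a c : S → ℝ) :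
    ∑ W : Finset S, (∏ i, if i ∈ W then a i else 1 - a i) * ∑ i ∈ W, c i = ∑ i, c i * a i := by
  have marginal : ∀ j, ∑ W : Finset S, (∏ i, if i ∈ W then a i else 1 - a i) *
      (if j ∈ W then 1 else 0) = a j := by
    intro j
    -- Replacing the factor 1 - a j by 0 kills exactly the sets that miss j, so the product formula
    -- yields the marginal of j.
    have h := sum_prod_ite_mem a (fun i => if i = j then 0 else 1 - a i)
    have h2 : ∏ i, (a i + if i = j then 0 else 1 - a i) = a j := by
      rw [← Finset.mul_prod_erase _ _ (Finset.mem_univ j), Finset.prod_eq_one]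
      · simp
      · intro i hi
        simp [Finset.ne_of_mem_erase hi]
    rw [← h2, ← h]
    refine Finset.sum_congr rfl fun W _ => ?_
    by_cases hj : j ∈ W
    · simp only [hj, if_true, mul_one]
      refine Finset.prod_congr rfl fun i _ => ?_
      by_cases hi : i ∈ W
      · simp [hi]
      · have : i ≠ j := fun h => hi (h ▸ hj)
        simp [hi, this]
    · simp only [hj, if_false, mul_zero]
      exact (Finset.prod_eq_zero (Finset.mem_univ j) (by simp [hj])).symm
  calc _ = ∑ W : Finset S, ∑ j, c j * ((∏ i, if i ∈ W then a i else 1 - a i) *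
      (if j ∈ W then 1 else 0)) := by
        refine Finset.sum_congr rfl fun W _ => ?_
        rw [Finset.mul_sum, ← Finset.sum_filter_add_sum_filter_not Finset.univ (· ∈ W)]
        rw [Finset.sum_eq_zero (s := Finset.univ.filter (¬ · ∈ W))]
        · rw [add_zero]
          refine Finset.sum_congr (by ext; simp) fun i hi => ?_
          simp only [Finset.mem_filter, Finset.mem_univ, true_and] at hi
          simp [hi, mul_comm]
        · intro i hi
          simp only [Finset.mem_filter, Finset.mem_univ, true_and] at hi
          simp [hi]
    _ = _ := by
        rw [Finset.sum_comm]
        refine Finset.sum_congr rfl fun j _ => ?_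
        rw [← Finset.mul_sum, marginal]

/-! ### Lower bounds on the optimum, and the potential -/

namespace CoveringProblem

variable {U S : Type*} [DecidableEq S]

theorem setCost_add (P : CoveringProblem U S) (R R' : Multiset S) :
    P.setCost (R + R') = P.setCost R + P.setCost R' := by
  simp [setCost]

theorem setCost_val (P : CoveringProblem U S) (W : Finset S) :
    P.setCost W.val = ∑ i ∈ W, P.cost i := rfl

theorem setCost_nonneg (P : CoveringProblem U S) (R : Multiset S) : 0 ≤ P.setCost R :=
  Multiset.sum_nonneg (by simpa using fun i _ => P.cost_nonneg i)

/-- Minimality against the empty multiset: buying any R' saves e at most the cost of R'. This makes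
kappa / M at most 1 when M ≥ c(OPT), so the sampling probabilities are genuine, and it bounds the
initial potential. -/
theorem aug_le_opt [Fintype U] (P : CoveringProblem U S) (e : U) (R : Multiset S) :
    P.aug e R ≤ P.opt := by
  refine le_ciInf fun R' => (P.aug_mono e 0 R (Multiset.zero_le R)).trans ?_
  have h1 := P.aug_minimal e 0 R' (Multiset.zero_le R')
  rw [Multiset.sub_zero] at h1
  have h2 : P.aug e R' ≤ ∑ e, P.aug e R' :=
    Finset.single_le_sum (fun e _ => P.aug_nonneg e R') (Finset.mem_univ e)
  unfold setCost
  linarith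

/-- Only the empty multiset competes for the optimum. This excludes m = 0 before the stopping time,
where the convention log(mn) = 0 would leave no room. -/
theorem sum_aug_le_opt_of_isEmpty [Fintype U] [IsEmpty S] (P : CoveringProblem U S) :
    ∑ e, P.aug e 0 ≤ P.opt := by
  refine le_ciInf fun R => ?_
  have hR : R = 0 := Multiset.eq_zero_of_forall_notMem fun i => isEmptyElim i
  have := P.setCost_nonneg R
  subst hR
  linarith

end CoveringProblem

namespace AugScheme

variable {U S : Type*} [DecidableEq S] {P : CoveringProblem U S} {α : ℝ}

theorem kappa_nonneg (A : AugScheme P α) (hα : 1 ≤ α) (e : U) (R : Multiset S) :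
    0 ≤ A.kappa e R :=
  (div_nonneg (P.aug_nonneg e R) (by linarith)).trans (A.le_kappa e R)

theorem owned_append (A : AugScheme P α) (h : History U S) (e : U) (W : Finset S) :
    A.owned (h ++ [(e, W)]) = A.owned h + (A.backup e (A.owned h) + W.val) := by
  simp [owned, add_assoc]

theorem owned_le_append (A : AugScheme P α) (h : History U S) (e : U) (W : Finset S) :
    A.owned h ≤ A.owned (h ++ [(e, W)]) := by
  rw [owned_append]
  exact Multiset.le_add_right _ _

theorem stepCost_le (A : AugScheme P α) (h : History U S) (e : U) (W : Finset S) :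
    A.stepCost h (e, W) ≤ α * A.kappa e (A.owned h) + ∑ i ∈ W, P.cost i := by
  have h1 := A.backup_cost e (A.owned h)
  have h2 := P.aug_mono e (A.owned h + A.backup e (A.owned h)) (A.owned (h ++ [(e, W)]))
    (by rw [owned_append, ← add_assoc]; exact Multiset.le_add_right _ _)
  unfold stepCost
  rw [show A.owned (h ++ [(e, W)]) - A.owned h = A.backup e (A.owned h) + W.val by
    rw [owned_append, add_tsub_cancel_left], P.setCost_add, P.setCost_val]
  linarith

variable [Fintype U] [DecidableEq U]

omit [DecidableEq S] in
theorem remaining_append (h : History U S) (e : U) (W : Finset S) :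
    remaining (h ++ [(e, W)]) = (remaining h).erase e := by
  ext f
  simp only [remaining, Finset.mem_sdiff, Finset.mem_univ, true_and, Finset.mem_erase,
    List.mem_toFinset, List.map_append, List.mem_append, List.map_cons, List.map_nil,
    List.mem_singleton, not_or]
  tauto

theorem potential_nonneg (A : AugScheme P α) (hα : 1 ≤ α) (h : History U S) :
    0 ≤ A.potential h :=
  Finset.sum_nonneg fun _ _ => A.kappa_nonneg hα _ _

theorem potential_append_le (A : AugScheme P α) (hα : 1 ≤ α) (h : History U S) (e : U)
    (W : Finset S) : A.potential (h ++ [(e, W)]) ≤ A.potential h := by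
  unfold potential
  rw [remaining_append]
  calc _ ≤ ∑ f ∈ (remaining h).erase e, A.kappa f (A.owned h) :=
        Finset.sum_le_sum fun f _ => A.kappa_mono f _ _ (A.owned_le_append h e W)
    _ ≤ _ := Finset.sum_le_sum_of_subset_of_nonneg (Finset.erase_subset _ _)
        fun _ _ _ => A.kappa_nonneg hα _ _

theorem kappa_add_potential_append_le (A : AugScheme P α) (h : History U S) {e : U}
    (he : e ∈ remaining h) (W : Finset S) :
    A.kappa e (A.owned h) + A.potential (h ++ [(e, W)]) ≤ A.potential h := by
  unfold potential
  rw [remaining_append, ← Finset.add_sum_erase _ _ he]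
  gcongr with f hf
  exact A.kappa_mono f _ _ (A.owned_le_append h e W)

/-- The real gain still counts the arriving element after the step, whereas the potential drops it
altogether; the difference is its new, nonnegative estimate. -/
theorem sum_kappa_sub_le (A : AugScheme P α) (hα : 1 ≤ α) (h : History U S) {e : U}
    (he : e ∈ remaining h) (W : Finset S) :
    ∑ f ∈ remaining h, (A.kappa f (A.owned h) - A.kappa f (A.owned (h ++ [(e, W)]))) ≤
      A.potential h - A.potential (h ++ [(e, W)]) := by
  unfold potential
  rw [remaining_append, Finset.sum_sub_distrib,
    ← Finset.add_sum_erase _ (fun f => A.kappa f (A.owned (h ++ [(e, W)]))) he]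
  linarith [A.kappa_nonneg hα e (A.owned (h ++ [(e, W)]))]

theorem potential_le_sum_aug (A : AugScheme P α) (hα : 1 ≤ α) :
    A.potential [] ≤ ∑ e, P.aug e 0 := by
  unfold potential
  calc _ ≤ ∑ e, A.kappa e (A.owned []) :=
        Finset.sum_le_sum_of_subset_of_nonneg (Finset.subset_univ _)
          fun _ _ _ => A.kappa_nonneg hα _ _
    _ ≤ _ := Finset.sum_le_sum fun e _ => A.kappa_le e _

theorem potential_le_card_mul_opt (A : AugScheme P α) (hα : 1 ≤ α) :
    A.potential [] ≤ Fintype.card U * P.opt := by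
  refine (A.potential_le_sum_aug hα).trans ?_
  refine (Finset.sum_le_card_nsmul _ _ _ fun e _ => P.aug_le_opt e 0).trans ?_
  simp

omit [DecidableEq U] in
theorem kappa_div_mem (A : AugScheme P α) (hα : 1 ≤ α) {M : ℝ} (hM : P.opt ≤ M)
    (h : History U S) (e : U) :
    0 ≤ A.kappa e (A.owned h) / M ∧ A.kappa e (A.owned h) / M ≤ 1 := by
  have h0 := A.kappa_nonneg hα e (A.owned h)
  have h1 := (A.kappa_le e (A.owned h)).trans ((P.aug_le_opt e _).trans hM)
  exact ⟨div_nonneg h0 (h0.trans h1), div_le_one_of_le₀ h1 (h0.trans h1)⟩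

end AugScheme

/-! ### Expectations over trajectories and the cost after stopping -/

namespace MonoOCO

variable {U S : Type*} [Fintype U] [DecidableEq U] [Fintype S] [DecidableEq S]
  {P : CoveringProblem U S} {α M : ℝ}

theorem sampleProb_nonneg (A : AugScheme P α) (O : MirrorDescent P M) (hα : 1 ≤ α)
    (hM : P.opt ≤ M) (h : History U S) (e : U) (W : Finset S) : 0 ≤ sampleProb A O h e W := by
  obtain ⟨h0, h1⟩ := A.kappa_div_mem hα hM h e
  refine Finset.prod_nonneg fun i _ => ?_
  obtain ⟨p0, p1⟩ := (O.play_mem h).1 i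
  split_ifs
  · positivity
  · exact sub_nonneg.2 (mul_le_one₀ h1 p0 p1)

omit [Fintype U] [DecidableEq U] in
theorem sum_sampleProb (A : AugScheme P α) (O : MirrorDescent P M) (h : History U S) (e : U) :
    ∑ W, sampleProb A O h e W = 1 := by
  unfold sampleProb
  rw [sum_prod_ite_mem]
  simp

/-- The backup guarantee pays α κ, and by linearity the sampled resources cost (κ/M)⟨c, p⟩ ≤ κ ≤ α
κ. -/
theorem sum_sampleProb_mul_stepCost_le (A : AugScheme P α) (O : MirrorDescent P M) (hα : 1 ≤ α)
    (hM : P.opt ≤ M) (h : History U S) (e : U) :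
    ∑ W, sampleProb A O h e W * A.stepCost h (e, W) ≤ 2 * α * A.kappa e (A.owned h) := by
  obtain ⟨h0, -⟩ := A.kappa_div_mem hα hM h e
  have hk := A.kappa_nonneg hα e (A.owned h)
  calc _ ≤ ∑ W, sampleProb A O h e W *
        (α * A.kappa e (A.owned h) + ∑ i ∈ W, P.cost i) :=
        Finset.sum_le_sum fun W _ => mul_le_mul_of_nonneg_left (A.stepCost_le h e W)
          (sampleProb_nonneg A O hα hM h e W)
    _ = α * A.kappa e (A.owned h) +
        A.kappa e (A.owned h) / M * ∑ i, P.cost i * O.play h i := by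
        simp only [mul_add, Finset.sum_add_distrib]
        rw [← Finset.sum_mul, sum_sampleProb, one_mul]
        congr 1
        unfold sampleProb
        rw [sum_prod_ite_mem_mul_sum, Finset.mul_sum]
        exact Finset.sum_congr rfl fun i _ => by ring
    _ ≤ α * A.kappa e (A.owned h) + A.kappa e (A.owned h) := by
        gcongr
        refine (mul_le_mul_of_nonneg_left (O.play_mem h).2 h0).trans ?_
        rcases eq_or_ne M 0 with rfl | hM0
        · simpa using hk
        · rw [div_mul_cancel₀ _ hM0]
    _ ≤ _ := by nlinarith

theorem stepProb_nonneg (A : AugScheme P α) (O : MirrorDescent P M) (hα : 1 ≤ α)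
    (hM : P.opt ≤ M) (h : History U S) (x : U × Finset S) : 0 ≤ stepProb A O h x := by
  unfold stepProb
  split_ifs
  · exact mul_nonneg (by positivity) (sampleProb_nonneg A O hα hM h _ _)
  · exact le_rfl

theorem sum_stepProb_mul (A : AugScheme P α) (O : MirrorDescent P M) (h : History U S)
    (f : U × Finset S → ℝ) :
    ∑ x, stepProb A O h x * f x = 1 / ((remaining h).card : ℝ) *
      ∑ e ∈ remaining h, ∑ W, sampleProb A O h e W * f (e, W) := by
  rw [Fintype.sum_prod_type, Finset.mul_sum, ← Finset.sum_subset (Finset.subset_univ (remaining h))]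
  · refine Finset.sum_congr rfl fun e he => ?_
    rw [Finset.mul_sum]
    exact Finset.sum_congr rfl fun W _ => by simp [stepProb, he, mul_assoc]
  · intro e _ he
    simp [stepProb, he]

theorem sum_stepProb_mul_le (A : AugScheme P α) (O : MirrorDescent P M) (h : History U S)
    (f : U × Finset S → ℝ) (b : U → ℝ)
    (hf : ∀ e ∈ remaining h, ∑ W, sampleProb A O h e W * f (e, W) ≤ b e) :
    ∑ x, stepProb A O h x * f x ≤ 1 / ((remaining h).card : ℝ) * ∑ e ∈ remaining h, b e := by
  rw [sum_stepProb_mul]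
  exact mul_le_mul_of_nonneg_left (Finset.sum_le_sum hf) (by positivity)

theorem sum_stepProb (A : AugScheme P α) (O : MirrorDescent P M) {h : History U S}
    (hh : (remaining h).Nonempty) : ∑ x, stepProb A O h x = 1 := by
  have h1 := sum_stepProb_mul A O h (fun _ => 1)
  simp only [mul_one, sum_sampleProb, Finset.sum_const, nsmul_eq_mul] at h1
  rw [h1]
  have : ((remaining h).card : ℝ) ≠ 0 := by exact_mod_cast hh.card_pos.ne'
  field_simp

omit [Fintype S] [DecidableEq S] in
theorem remaining_nonempty_of_length_lt {h : History U S} (hh : h.length < Fintype.card U) :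
    (remaining h).Nonempty := by
  rw [← Finset.card_pos]
  unfold remaining
  have h1 := Finset.le_card_sdiff (h.map Prod.fst).toFinset (Finset.univ : Finset U)
  have h2 := List.toFinset_card_le (h.map Prod.fst)
  rw [List.length_map] at h2
  rw [Finset.card_univ] at h1
  omega

theorem Reachable.nodup {A : AugScheme P α} {O : MirrorDescent P M} {h : History U S}
    (hh : Reachable A O h) : (h.map Prod.fst).Nodup := by
  induction hh with
  | nil => simp
  | snoc h x _ hx ih =>
    have hx' : x.1 ∈ remaining h := by
      by_contra hc
      simp [stepProb, hc] at hx
    rw [List.map_append, List.nodup_append]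
    refine ⟨ih, by simp, ?_⟩
    simp only [remaining, Finset.mem_sdiff, Finset.mem_univ, true_and, List.mem_toFinset] at hx'
    intro a ha b hb
    simp only [List.map_cons, List.map_nil, List.mem_singleton] at hb
    rintro rfl
    exact hx' (hb ▸ ha)

theorem Reachable.remaining_eq_empty {A : AugScheme P α} {O : MirrorDescent P M}
    {h : History U S} (hh : Reachable A O h) (hl : h.length = Fintype.card U) :
    remaining h = ∅ := by
  have h1 : (h.map Prod.fst).toFinset = Finset.univ := by
    rw [← Finset.card_eq_iff_eq_univ, List.toFinset_card_of_nodup hh.nodup, List.length_map, hl]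
  simp [remaining, h1]

/-- The probability of the trajectory prefix `ω`. -/
noncomputable def prefixProb (A : AugScheme P α) (O : MirrorDescent P M) {k : ℕ}
    (ω : Fin k → U × Finset S) : ℝ :=
  ∏ t : Fin k, stepProb A O ((List.ofFn ω).take t) (ω t)

theorem prefixProb_nonneg (A : AugScheme P α) (O : MirrorDescent P M) (hα : 1 ≤ α)
    (hM : P.opt ≤ M) {k : ℕ} (ω : Fin k → U × Finset S) : 0 ≤ prefixProb A O ω :=
  Finset.prod_nonneg fun _ _ => stepProb_nonneg A O hα hM _ _

theorem reachable_take {A : AugScheme P α} {O : MirrorDescent P M} (hα : 1 ≤ α)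
    (hM : P.opt ≤ M) {k : ℕ} {ω : Fin k → U × Finset S} (hω : prefixProb A O ω ≠ 0) (t : ℕ)
    (ht : t ≤ k) : Reachable A O ((List.ofFn ω).take t) := by
  induction t with
  | zero => simpa using Reachable.nil
  | succ t ih =>
    have h1 := ih (by omega)
    have h2 := Finset.prod_ne_zero_iff.1 hω ⟨t, ht⟩ (Finset.mem_univ _)
    have h3 := Reachable.snoc _ _ h1 ((stepProb_nonneg A O hα hM _ _).lt_of_ne' h2)
    rw [List.take_succ_eq_append_getElem (by simpa using ht)]
    simpa using h3

theorem reachable_ofFn {A : AugScheme P α} {O : MirrorDescent P M} (hα : 1 ≤ α)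
    (hM : P.opt ≤ M) {k : ℕ} {ω : Fin k → U × Finset S} (hω : prefixProb A O ω ≠ 0) :
    Reachable A O (List.ofFn ω) := by
  have := reachable_take hα hM hω k le_rfl
  rwa [List.take_of_length_le (by simp)] at this

theorem ofFn_snoc {X : Type*} {k : ℕ} (ω : Fin k → X) (x : X) :
    List.ofFn (Fin.snoc ω x : Fin (k + 1) → X) = List.ofFn ω ++ [x] := by
  rw [List.ofFn_succ']
  simp

theorem take_ofFn_snoc {X : Type*} {k : ℕ} (ω : Fin k → X) (x : X) {t : ℕ} (ht : t ≤ k) :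
    (List.ofFn (Fin.snoc ω x : Fin (k + 1) → X)).take t = (List.ofFn ω).take t := by
  rw [ofFn_snoc, List.take_append_of_le_length (by simpa using ht)]

theorem prefixProb_snoc (A : AugScheme P α) (O : MirrorDescent P M) {k : ℕ}
    (ω : Fin k → U × Finset S) (x : U × Finset S) :
    prefixProb A O (Fin.snoc ω x : Fin (k + 1) → U × Finset S) =
      prefixProb A O ω * stepProb A O (List.ofFn ω) x := by
  unfold prefixProb
  rw [Fin.prod_univ_castSucc]
  congr 1
  · refine Finset.prod_congr rfl fun t _ => ?_
    rw [Fin.val_castSucc, take_ofFn_snoc _ _ t.2.le, Fin.snoc_castSucc]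
  · rw [Fin.val_last, take_ofFn_snoc _ _ le_rfl, Fin.snoc_last,
      List.take_of_length_le (by simp)]

theorem sum_snoc {X : Type*} [Fintype X] {k : ℕ} (F : (Fin (k + 1) → X) → ℝ) :
    ∑ ω, F ω = ∑ ω : Fin k → X, ∑ x, F (Fin.snoc ω x : Fin (k + 1) → X) := by
  rw [← (Fin.snocEquiv fun _ => X).sum_comp, Fintype.sum_prod_type_right]
  rfl

/-- Supermartingale argument: if `V` pays in expectation for the reward `r` and its own next value,
then the rewards telescope. Induction on the length conditions on the last step. -/
theorem sum_prefixProb_mul_le (A : AugScheme P α) (O : MirrorDescent P M) (hα : 1 ≤ α)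
    (hM : P.opt ≤ M) (r : History U S → U × Finset S → ℝ) (V : History U S → ℝ)
    (hV : ∀ h, Reachable A O h → (remaining h).Nonempty →
      ∑ x, stepProb A O h x * (r h x + V (h ++ [x])) ≤ V h) (k : ℕ) (hk : k ≤ Fintype.card U) :
    ∑ ω : Fin k → U × Finset S, prefixProb A O ω *
      (∑ t : Fin k, r ((List.ofFn ω).take t) (ω t) + V (List.ofFn ω)) ≤ V [] := by
  induction k with
  | zero => simp [prefixProb]
  | succ k ih =>
    refine le_trans ?_ (ih (by omega))
    rw [sum_snoc]
    refine Finset.sum_le_sum fun ω _ => ?_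
    have hne : (remaining (List.ofFn ω)).Nonempty :=
      remaining_nonempty_of_length_lt (by simpa using hk)
    have h1 : ∀ x : U × Finset S,
        prefixProb A O (Fin.snoc ω x : Fin (k + 1) → U × Finset S) *
        (∑ t : Fin (k + 1), r ((List.ofFn (Fin.snoc ω x : Fin (k + 1) → U × Finset S)).take t)
          ((Fin.snoc ω x : Fin (k + 1) → U × Finset S) t) +
          V (List.ofFn (Fin.snoc ω x : Fin (k + 1) → U × Finset S))) =
        prefixProb A O ω * (stepProb A O (List.ofFn ω) x *
            ∑ t : Fin k, r ((List.ofFn ω).take t) (ω t) +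
          stepProb A O (List.ofFn ω) x * (r (List.ofFn ω) x + V (List.ofFn ω ++ [x]))) := by
      intro x
      rw [prefixProb_snoc, ofFn_snoc, Fin.sum_univ_castSucc, Fin.snoc_last, Fin.val_last,
        List.take_append_of_le_length (by simp), List.take_of_length_le (by simp)]
      have : ∀ t : Fin k, r ((List.ofFn ω ++ [x]).take (t.castSucc : Fin (k + 1)))
          ((Fin.snoc ω x : Fin (k + 1) → U × Finset S) t.castSucc) =
          r ((List.ofFn ω).take t) (ω t) := by
        intro t
        rw [Fin.snoc_castSucc, Fin.val_castSucc, List.take_append_of_le_length (by simp [t.2.le])]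
      simp only [this]
      ring
    simp only [h1]
    rw [← Finset.mul_sum, Finset.sum_add_distrib, ← Finset.sum_mul, sum_stepProb A O hne, one_mul]
    -- The drift inequality is available only after reachable histories; the other prefixes carry no
    -- mass.
    by_cases h0 : prefixProb A O ω = 0
    · simp [h0]
    · refine mul_le_mul_of_nonneg_left ?_ (prefixProb_nonneg A O hα hM ω)
      linarith [hV _ (reachable_ofFn hα hM h0) hne]

theorem expect_sum_le (A : AugScheme P α) (O : MirrorDescent P M) (hα : 1 ≤ α)
    (hM : P.opt ≤ M) (r : History U S → U × Finset S → ℝ) (V : History U S → ℝ)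
    (hV0 : ∀ h, 0 ≤ V h)
    (hV : ∀ h, Reachable A O h → (remaining h).Nonempty →
      ∑ x, stepProb A O h x * (r h x + V (h ++ [x])) ≤ V h) :
    expect A O (fun ω => ∑ t : Fin (Fintype.card U), r (past ω t) (ω t)) ≤ V [] := by
  refine le_trans ?_ (sum_prefixProb_mul_le A O hα hM r V hV _ le_rfl)
  refine Finset.sum_le_sum fun ω _ => ?_
  exact mul_le_mul_of_nonneg_left (le_add_of_nonneg_right (hV0 _)) (prefixProb_nonneg A O hα hM ω)

theorem expect_congr (A : AugScheme P α) (O : MirrorDescent P M) {f g : Trajectory U S → ℝ}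
    (hfg : ∀ ω, prob A O ω ≠ 0 → f ω = g ω) : expect A O f = expect A O g := by
  refine Finset.sum_congr rfl fun ω _ => ?_
  by_cases h0 : prob A O ω = 0
  · simp [h0]
  · rw [hfg ω h0]

omit [Fintype S] in
theorem potential_past_antitone (A : AugScheme P α) (hα : 1 ≤ α) (ω : Trajectory U S) :
    Antitone fun t => A.potential (past ω t) := by
  refine antitone_nat_of_succ_le fun t => ?_
  unfold past
  by_cases ht : t < (List.ofFn ω).length
  · rw [List.take_succ_eq_append_getElem ht]
    exact A.potential_append_le hα _ _ _
  · rw [List.take_of_length_le (by omega), List.take_of_length_le (by omega)]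

/-- The potential is non-increasing, so the stopping condition persists. Positive probability
matters: then all elements have arrived at time n and the potential is 0 ≤ M, so the infimum is not
the default value 0 of the empty set. -/
theorem lt_stopTime_iff (A : AugScheme P α) (O : MirrorDescent P M) (hα : 1 ≤ α)
    (hM : P.opt ≤ M) (hM0 : 0 ≤ M) {ω : Trajectory U S} (hω : prob A O ω ≠ 0) (t : ℕ) :
    t < stopTime A M ω ↔ M < A.potential (past ω t) := by
  constructor
  · intro h
    simpa using Nat.notMem_of_lt_sInf h
  · intro h
    by_contra hc
    have hne : {t : ℕ | A.potential (past ω t) ≤ M}.Nonempty := by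
      refine ⟨Fintype.card U, ?_⟩
      have h1 : past ω (Fintype.card U) = List.ofFn ω := List.take_of_length_le (by simp)
      have h2 := (reachable_ofFn hα hM (A := A) (O := O) hω).remaining_eq_empty (by simp)
      simp [h1, AugScheme.potential, h2, hM0]
    exact absurd ((potential_past_antitone A hα ω (not_lt.1 hc)).trans (Nat.sInf_mem hne))
      (not_le.2 h)

/-- The supermartingale is 2α min(Φ, M). Below level M, the arrival of e costs at most 2α κ_e in
expectation and leaves a potential of at most Φ - κ_e; above it nothing is charged, and the cap M
does not increase. -/
theorem expect_totalCost_le (A : AugScheme P α) (O : MirrorDescent P M) (hα : 1 ≤ α)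
    (hM : P.opt ≤ M) (hM0 : 0 ≤ M) :
    expect A O (totalCost A) ≤ expect A O (costBeforeStop A M) + 2 * α * M := by
  have h1 : expect A O (totalCost A) = expect A O (costBeforeStop A M) +
      expect A O (fun ω => ∑ t : Fin (Fintype.card U),
        if A.potential (past ω t) ≤ M then A.stepCost (past ω t) (ω t) else 0) := by
    unfold expect
    rw [← Finset.sum_add_distrib]
    simp only [← mul_add]
    refine expect_congr A O fun ω hω => ?_
    unfold totalCost costBeforeStop
    rw [← Finset.sum_add_distrib]
    refine Finset.sum_congr rfl fun t _ => ?_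
    rw [if_congr (lt_stopTime_iff A O hα hM hM0 hω t) rfl rfl]
    by_cases h : M < A.potential (past ω t)
    · simp [h, not_le.2 h]
    · simp [h, not_lt.1 h]
  rw [h1]
  gcongr
  refine (expect_sum_le A O hα hM
    (fun h x => if A.potential h ≤ M then A.stepCost h x else 0)
    (fun h => 2 * α * min (A.potential h) M)
    (fun h => mul_nonneg (by linarith) (le_min (A.potential_nonneg hα h) hM0)) ?_).trans ?_
  · intro h _ hne
    by_cases hp : A.potential h ≤ M
    · simp only [if_pos hp, min_eq_left hp]
      refine (sum_stepProb_mul_le A O h _ (fun _ => 2 * α * A.potential h) ?_).trans ?_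
      · intro e he
        calc _ ≤ ∑ W, (sampleProb A O h e W * A.stepCost h (e, W) + sampleProb A O h e W *
              (2 * α * (A.potential h - A.kappa e (A.owned h)))) := by
              refine Finset.sum_le_sum fun W _ => ?_
              rw [← mul_add]
              have := A.kappa_add_potential_append_le h he W
              refine mul_le_mul_of_nonneg_left ?_ (sampleProb_nonneg A O hα hM h e W)
              gcongr
              exact (min_le_left _ _).trans (by linarith)
          _ ≤ _ := by
              rw [Finset.sum_add_distrib, ← Finset.sum_mul, sum_sampleProb]
              linarith [sum_sampleProb_mul_stepCost_le A O hα hM h e]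
      · have : ((remaining h).card : ℝ) ≠ 0 := by exact_mod_cast hne.card_pos.ne'
        rw [Finset.sum_const, nsmul_eq_mul, ← mul_assoc, one_div, inv_mul_cancel₀ this, one_mul]
    · simp only [if_neg hp, zero_add, min_eq_right (not_le.1 hp).le]
      calc _ ≤ ∑ x, stepProb A O h x * (2 * α * M) := by
            refine Finset.sum_le_sum fun x _ => ?_
            refine mul_le_mul_of_nonneg_left ?_ (stepProb_nonneg A O hα hM h x)
            gcongr
            exact min_le_right _ _
        _ = _ := by rw [← Finset.sum_mul, sum_stepProb A O hne, one_mul]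
  · gcongr
    exact min_le_right _ _

end MonoOCO

/-! ### Mirror descent with the weighted entropy -/

theorem mul_log_div_sub_add_nonneg {p x : ℝ} (hp : 0 ≤ p) (hx : 0 < x) :
    0 ≤ p * Real.log (p / x) - p + x := by
  rcases hp.eq_or_lt with rfl | hp
  · simpa using hx.le
  · have h1 := mul_le_mul_of_nonneg_left (Real.log_le_sub_one_of_pos (div_pos hx hp)) hp.le
    have h2 : p * (x / p - 1) = x - p := by field_simp
    rw [h2, ← inv_div, Real.log_inv] at h1
    linarith

theorem mul_log_div {z q : ℝ} (hz : 0 ≤ z) (hq : 0 < q) :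
    z * Real.log (z / q) = z * Real.log z - z * Real.log q := by
  rcases hz.eq_or_lt with rfl | hz
  · simp
  · rw [Real.log_div hz.ne' hq.ne']
    ring

namespace CoveringProblem

variable {U S : Type*} [DecidableEq S] [Fintype S] {P : CoveringProblem U S} {M : ℝ}

theorem convex_simplex (P : CoveringProblem U S) (M : ℝ) : Convex ℝ (P.simplex M) := by
  intro p hp z hz a b ha hb hab
  refine ⟨fun i => ?_, ?_⟩
  · obtain ⟨h1, h2⟩ := hp.1 i
    obtain ⟨h3, h4⟩ := hz.1 i
    simp only [Pi.add_apply, Pi.smul_apply, smul_eq_mul]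
    exact ⟨by positivity, by nlinarith⟩
  · have h : ∑ i, P.cost i * (a • p + b • z) i =
        a * ∑ i, P.cost i * p i + b * ∑ i, P.cost i * z i := by
      rw [Finset.mul_sum, Finset.mul_sum, ← Finset.sum_add_distrib]
      refine Finset.sum_congr rfl fun i _ => ?_
      simp only [Pi.add_apply, Pi.smul_apply, smul_eq_mul]
      ring
    rw [h]
    have h1 := mul_le_mul_of_nonneg_left hp.2 ha
    have h2 := mul_le_mul_of_nonneg_left hz.2 hb
    calc _ ≤ a * M + b * M := add_le_add h1 h2
      _ = M := by rw [← add_mul, hab, one_mul]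

theorem zero_mem_simplex (P : CoveringProblem U S) (hM : 0 ≤ M) : 0 ∈ P.simplex M :=
  ⟨fun i => by simp, by simpa using hM⟩

theorem exists_pos_mem_simplex (P : CoveringProblem U S) (hM : 0 < M) :
    ∃ z ∈ P.simplex M, ∀ i, 0 < z i := by
  have hc : 0 ≤ ∑ i, P.cost i := Finset.sum_nonneg fun i _ => P.cost_nonneg i
  have hpos : 0 < min 1 (M / (∑ i, P.cost i + 1)) := lt_min one_pos (by positivity)
  refine ⟨fun _ => min 1 (M / (∑ i, P.cost i + 1)),
    ⟨fun i => ⟨hpos.le, min_le_left _ _⟩, ?_⟩, fun i => hpos⟩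
  rw [← Finset.sum_mul]
  calc _ ≤ (∑ i, P.cost i) * (M / (∑ i, P.cost i + 1)) := by
        gcongr
        exact min_le_right _ _
    _ ≤ (∑ i, P.cost i + 1) * (M / (∑ i, P.cost i + 1)) := by
        gcongr
        linarith
    _ = M := by field_simp

theorem divergence_nonneg (P : CoveringProblem U S) (hM : 0 ≤ M) {p q : S → ℝ}
    (hp : ∀ i, 0 ≤ p i) (hq : ∀ i, 0 < P.cost i → 0 < q i) : 0 ≤ P.divergence M p q := by
  refine Finset.sum_nonneg fun i _ => ?_
  rcases (P.cost_nonneg i).eq_or_lt with h | h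
  · simp [← h]
  · exact mul_nonneg (div_nonneg h.le hM) (mul_log_div_sub_add_nonneg (hp i) (hq i h))

section Minimizer

variable {c : ℝ} {G p q : S → ℝ}

/-- Convexity bounds the increase from p to a point x of the segment towards z by the gradient at x.
The gradient is taken at x rather than p because p is not yet known to be positive, and the
logarithm is singular at 0. -/
theorem minimizer_segment_inequality (hM : 0 < M) (hc : 0 < c) (hp : p ∈ P.simplex M)
    (hq : ∀ i, 0 < P.cost i → 0 < q i)
    (hmin : IsMinOn (fun p => -(∑ i, G i * p i) + c * P.divergence M p q) (P.simplex M) p)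
    {z : S → ℝ} (hz : z ∈ P.simplex M) {ε : ℝ} (h0 : 0 < ε) (h1 : ε ≤ 1)
    (hx : ∀ i, 0 < P.cost i → 0 < p i + ε * (z i - p i)) :
    0 ≤ ∑ i, (-G i + c * (P.cost i / M * (Real.log (p i + ε * (z i - p i)) - Real.log (q i)))) *
      (z i - p i) := by
  have hmem : (fun i => p i + ε * (z i - p i)) ∈ P.simplex M := by
    convert P.convex_simplex M hp hz (sub_nonneg.2 h1) h0.le (by ring) using 1
    ext i
    simp only [Pi.add_apply, Pi.smul_apply, smul_eq_mul]
    ring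
  have h2 := sub_nonneg.2 (isMinOn_iff.1 hmin _ hmem)
  simp only [divergence, Finset.mul_sum, ← Finset.sum_neg_distrib, ← Finset.sum_add_distrib,
    ← Finset.sum_sub_distrib] at h2
  refine nonneg_of_mul_nonneg_right (h2.trans ?_) h0
  rw [Finset.mul_sum]
  refine Finset.sum_le_sum fun i _ => ?_
  rcases (P.cost_nonneg i).eq_or_lt with h | h
  · simp only [← h, zero_div, zero_mul, mul_zero, add_zero]
    exact le_of_eq (by ring)
  · have hxi := hx i h
    have hpi := (hp.1 i).1
    have h3 := mul_log_div_sub_add_nonneg hpi hxi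
    rw [mul_log_div hpi hxi] at h3
    rw [mul_log_div hpi (hq i h), mul_log_div hxi.le (hq i h)]
    have h4 : 0 ≤ c * (P.cost i / M) := by positivity
    nlinarith [mul_nonneg h4 h3]

/-- The entropy has slope -∞ at the boundary, so moving from p slightly towards a strictly positive
z would decrease the objective if p j = 0. -/
theorem minimizer_pos (hM : 0 < M) (hc : 0 < c) (hp : p ∈ P.simplex M)
    (hq : ∀ i, 0 < P.cost i → 0 < q i)
    (hmin : IsMinOn (fun p => -(∑ i, G i * p i) + c * P.divergence M p q) (P.simplex M) p)
    {j : S} (hj : 0 < P.cost j) : 0 < p j := by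
  by_contra hpj
  have hpj : p j = 0 := le_antisymm (not_lt.1 hpj) (hp.1 j).1
  obtain ⟨z, hz, hzpos⟩ := P.exists_pos_mem_simplex hM
  set B : ℝ := ∑ i, (-G i + c * (P.cost i / M * (Real.log (z i) - Real.log (q i)))) * (z i - p i)
  have key : ∀ ε : ℝ, 0 < ε → ε ≤ 1 → 0 ≤ B + c * (P.cost j / M) * z j * Real.log ε := by
    intro ε h0 h1
    have hx : ∀ i, 0 < p i + ε * (z i - p i) := fun i => by
      have := (hp.1 i).1
      nlinarith [mul_pos h0 (hzpos i), mul_nonneg (sub_nonneg.2 h1) this]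
    refine (minimizer_segment_inequality hM hc hp hq hmin hz h0 h1 fun i _ => hx i).trans ?_
    rw [← sub_le_iff_le_add', ← Finset.sum_sub_distrib]
    -- Compared with the gradient at z itself, each coordinate contributes a nonpositive difference,
    -- since log is monotone; coordinate j contributes a multiple of log ε.
    have hterm : ∀ i, (-G i + c * (P.cost i / M * (Real.log (p i + ε * (z i - p i)) -
        Real.log (q i)))) * (z i - p i) -
        (-G i + c * (P.cost i / M * (Real.log (z i) - Real.log (q i)))) * (z i - p i) =
        c * (P.cost i / M) * ((Real.log (p i + ε * (z i - p i)) - Real.log (z i)) *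
          (z i - p i)) := fun i => by ring
    have hle : ∀ i, c * (P.cost i / M) * ((Real.log (p i + ε * (z i - p i)) - Real.log (z i)) *
          (z i - p i)) ≤ 0 := fun i => by
      refine mul_nonpos_of_nonneg_of_nonpos
        (mul_nonneg hc.le (div_nonneg (P.cost_nonneg i) hM.le)) ?_
      rcases le_total (p i) (z i) with h | h
      · refine mul_nonpos_of_nonpos_of_nonneg (sub_nonpos.2 (Real.log_le_log (hx i) ?_))
          (sub_nonneg.2 h)
        nlinarith
      · refine mul_nonpos_of_nonneg_of_nonpos (sub_nonneg.2 (Real.log_le_log (hzpos i) ?_))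
          (sub_nonpos.2 h)
        nlinarith
    simp only [hterm]
    rw [← Finset.add_sum_erase _ _ (Finset.mem_univ j)]
    refine (add_le_of_nonpos_right (Finset.sum_nonpos fun i _ => hle i)).trans (le_of_eq ?_)
    rw [hpj, sub_zero, zero_add, Real.log_mul h0.ne' (hzpos j).ne']
    ring
  have ha : 0 < c * (P.cost j / M) * z j := mul_pos (by positivity) (hzpos j)
  -- This ε makes the logarithmic term equal to -(|B| + 1), which beats B.
  have h1 := key (Real.exp (-((|B| + 1) / (c * (P.cost j / M) * z j)))) (Real.exp_pos _)
    (Real.exp_le_one_iff.2 (neg_nonpos.2 (by positivity)))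
  rw [Real.log_exp, mul_neg, mul_div_cancel₀ _ ha.ne'] at h1
  linarith [le_abs_self B]

/-- Let ε tend to 0 in the segment inequality; positivity of the minimizer makes the gradient
continuous there. -/
theorem minimizer_variational_inequality (hM : 0 < M) (hc : 0 < c) (hp : p ∈ P.simplex M)
    (hq : ∀ i, 0 < P.cost i → 0 < q i)
    (hmin : IsMinOn (fun p => -(∑ i, G i * p i) + c * P.divergence M p q) (P.simplex M) p)
    {z : S → ℝ} (hz : z ∈ P.simplex M) :
    0 ≤ ∑ i, (-G i + c * (P.cost i / M * (Real.log (p i) - Real.log (q i)))) * (z i - p i) := by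
  have hppos : ∀ i, 0 < P.cost i → 0 < p i := fun i hi => minimizer_pos hM hc hp hq hmin hi
  have hlim : Filter.Tendsto (fun ε : ℝ => ∑ i, (-G i + c * (P.cost i / M *
      (Real.log (p i + ε * (z i - p i)) - Real.log (q i)))) * (z i - p i))
      (nhdsWithin 0 (Set.Ioi 0))
      (nhds (∑ i, (-G i + c * (P.cost i / M * (Real.log (p i) - Real.log (q i)))) *
        (z i - p i))) := by
    refine tendsto_finsetSum _ fun i _ => ?_
    rcases (P.cost_nonneg i).eq_or_lt with h | h
    · simp only [← h, zero_div, zero_mul]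
      exact tendsto_const_nhds
    · have hcont : ContinuousAt (fun ε : ℝ => (-G i + c * (P.cost i / M *
          (Real.log (p i + ε * (z i - p i)) - Real.log (q i)))) * (z i - p i)) 0 := by
        have : p i + 0 * (z i - p i) ≠ 0 := by simpa using (hppos i h).ne'
        fun_prop (disch := assumption)
      have := hcont.tendsto
      simp only [zero_mul, add_zero] at this
      exact this.mono_left nhdsWithin_le_nhds
  refine ge_of_tendsto hlim ?_
  filter_upwards [Ioo_mem_nhdsGT (one_pos : (0 : ℝ) < 1)] with ε hε
  refine minimizer_segment_inequality hM hc hp hq hmin hz hε.1 hε.2.le fun i hi => ?_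
  nlinarith [mul_pos (sub_pos.2 hε.2) (hppos i hi), mul_nonneg hε.1.le (hz.1 i).1]

/-- The three-point identity for Bregman divergences rewrites the first-order condition. Coordinates
of cost 0 drop out of every divergence. -/
theorem minimizer_three_point_inequality (hM : 0 < M) (hc : 0 < c) (hp : p ∈ P.simplex M)
    (hq : ∀ i, 0 < P.cost i → 0 < q i)
    (hmin : IsMinOn (fun p => -(∑ i, G i * p i) + c * P.divergence M p q) (P.simplex M) p)
    {z : S → ℝ} (hz : z ∈ P.simplex M) :
    ∑ i, G i * z i + c * P.divergence M z p + (c * P.divergence M p q - ∑ i, G i * p i) ≤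
      c * P.divergence M z q := by
  have h := minimizer_variational_inequality hM hc hp hq hmin hz
  have hsum : ∑ i, (-G i + c * (P.cost i / M * (Real.log (p i) - Real.log (q i)))) *
      (z i - p i) = c * P.divergence M z q -
      (∑ i, G i * z i + c * P.divergence M z p +
        (c * P.divergence M p q - ∑ i, G i * p i)) := by
    simp only [divergence, Finset.mul_sum, ← Finset.sum_add_distrib, ← Finset.sum_sub_distrib]
    refine Finset.sum_congr rfl fun i _ => ?_
    rcases (P.cost_nonneg i).eq_or_lt with h | h
    · simp only [← h, zero_div, zero_mul, mul_zero, add_zero]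
      ring
    · have hpi := minimizer_pos hM hc hp hq hmin h
      rw [mul_log_div (hz.1 i).1 (hq i h), mul_log_div (hz.1 i).1 hpi, mul_log_div hpi.le (hq i h)]
      ring
  linarith

end Minimizer

/-- After the three-point inequality it remains to see that 2 D(p, q) - ⟨G, p⟩ + (3/2)⟨G, q⟩ ≥ 0.
This holds coordinatewise, by duality of entropy and exponential. -/
theorem mirror_step_inequality {G p q : S → ℝ} (hM : 0 < M) (hp : p ∈ P.simplex M)
    (hq : ∀ i, 0 < P.cost i → 0 < q i) (hG : ∀ i, 0 ≤ G i ∧ G i ≤ P.cost i / M)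
    (hmin : IsMinOn (fun p => -(∑ i, G i * p i) + 1 / (1 / 2 : ℝ) * P.divergence M p q)
      (P.simplex M) p)
    {z : S → ℝ} (hz : z ∈ P.simplex M) :
    ∑ i, G i * z i + 2 * P.divergence M z p ≤
      2 * P.divergence M z q + 3 / 2 * ∑ i, G i * q i := by
  rw [show 1 / (1 / 2 : ℝ) = 2 by norm_num] at hmin
  have h := minimizer_three_point_inequality hM two_pos hp hq hmin hz
  have h2 : 0 ≤ 2 * P.divergence M p q - ∑ i, G i * p i + 3 / 2 * ∑ i, G i * q i := by
    simp only [divergence, Finset.mul_sum, ← Finset.sum_add_distrib, ← Finset.sum_sub_distrib]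
    refine Finset.sum_nonneg fun i _ => ?_
    obtain ⟨hG0, hG1⟩ := hG i
    rcases (P.cost_nonneg i).eq_or_lt with h | h
    · rw [← h, zero_div] at hG1
      simp [← h, le_antisymm hG1 hG0]
    · have hw : 0 < P.cost i / M := div_pos h hM
      set w := P.cost i / M
      obtain ⟨g, hg⟩ : ∃ g, G i = w * g := ⟨G i / w, by field_simp⟩
      rw [hg] at hG0 hG1 ⊢
      have hg0 : 0 ≤ g := nonneg_of_mul_nonneg_right hG0 hw
      have hg1 : g ≤ 1 := by nlinarith
      have hqi := hq i h
      have hpi := (hp.1 i).1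
      -- From exp x ≤ 1 + x + x² with x = g/2 and g ≤ 1; twice 3/4 is the factor 3/2.
      have hexp : Real.exp (g / 2) ≤ 1 + 3 / 4 * g := by
        have := abs_le.1 (Real.abs_exp_sub_one_sub_id_le (x := g / 2)
          (by rw [abs_of_nonneg (by positivity)]; linarith))
        nlinarith [this.2]
      -- The reference value q exp(g/2) is the unconstrained maximizer of the mirror step in this
      -- coordinate.
      have h3 := mul_log_div_sub_add_nonneg hpi (mul_pos hqi (Real.exp_pos (g / 2)))
      rw [mul_log_div hpi (mul_pos hqi (Real.exp_pos _)),
        Real.log_mul hqi.ne' (Real.exp_pos _).ne', Real.log_exp] at h3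
      rw [mul_log_div hpi hqi]
      have h4 := mul_le_mul_of_nonneg_left hexp hqi.le
      have h5 : 0 ≤ 2 * w * (p i * Real.log (p i) - p i * Real.log (q i) - p i + q i
          - p i * (g / 2) + 3 / 4 * g * q i) := by
        refine mul_nonneg (by positivity) ?_
        linarith
      linarith
  linarith

theorem divergence_le_of_isMinOn {p q : S → ℝ} (hM : 0 < M) (hp : p ∈ P.simplex M)
    (hq : ∀ i, 0 < P.cost i → 0 < q i)
    (hmin : IsMinOn (fun p => P.divergence M p q) (P.simplex M) p)
    {z : S → ℝ} (hz : z ∈ P.simplex M) :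
    P.divergence M z p ≤ P.divergence M z q := by
  have h := minimizer_three_point_inequality (c := 1) (G := 0) hM one_pos hp hq
    (by simpa using hmin) hz
  have h2 := P.divergence_nonneg hM.le (fun i => (hp.1 i).1) hq
  simp only [Pi.zero_apply, zero_mul, Finset.sum_const_zero, one_mul] at h
  linarith

/-- The rescaled coordinates y i = cost i * z i / M are at most 1 and have sum at most 1, so y log(y
m) ≤ y log m; the uniform vector adds total mass 1. -/
theorem divergence_uniformPoint_le [Nonempty S] (hM : 0 < M) {z : S → ℝ}
    (hz : z ∈ P.simplex M) :
    P.divergence M z (P.uniformPoint M) ≤ Real.log (Fintype.card S) + 1 := by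
  have hm : (1 : ℝ) ≤ Fintype.card S := by exact_mod_cast Fintype.card_pos
  have hlog := Real.log_nonneg hm
  have hy : ∀ i, 0 ≤ P.cost i / M * z i := fun i =>
    mul_nonneg (div_nonneg (P.cost_nonneg i) hM.le) (hz.1 i).1
  have hsum : ∑ i, P.cost i / M * z i ≤ 1 := by
    have : ∑ i, P.cost i / M * z i = (∑ i, P.cost i * z i) / M := by
      rw [Finset.sum_div]
      exact Finset.sum_congr rfl fun i _ => by ring
    rw [this]
    exact div_le_one_of_le₀ hz.2 hM.le
  calc _ ≤ ∑ i, (P.cost i / M * z i * Real.log (Fintype.card S) + 1 / (Fintype.card S : ℝ)) := by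
        refine Finset.sum_le_sum fun i _ => ?_
        have hyi := hy i
        rcases (P.cost_nonneg i).eq_or_lt with h | h
        · simp [← h]
        · have hy1 : P.cost i / M * z i ≤ 1 :=
            (Finset.single_le_sum (fun i _ => hy i) (Finset.mem_univ i)).trans hsum
          have h1 : z i / P.uniformPoint M i = P.cost i / M * z i * Fintype.card S := by
            unfold uniformPoint
            field_simp
          have h2 : P.cost i / M * P.uniformPoint M i = 1 / (Fintype.card S : ℝ) := by
            unfold uniformPoint
            field_simp
          have h3 : P.cost i / M * z i * Real.log (P.cost i / M * z i * Fintype.card S) ≤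
              P.cost i / M * z i * Real.log (Fintype.card S) := by
            rcases hyi.eq_or_lt with h0 | h0
            · simp [← h0]
            · refine mul_le_mul_of_nonneg_left (Real.log_le_log (by positivity) ?_) hyi
              nlinarith
          rw [h1, mul_add, mul_sub, ← mul_assoc, h2]
          linarith
    _ = (∑ i, P.cost i / M * z i) * Real.log (Fintype.card S) + 1 := by
        rw [Finset.sum_add_distrib, ← Finset.sum_mul, Finset.sum_const, nsmul_eq_mul,
          Finset.card_univ, mul_one_div_cancel (by linarith)]
    _ ≤ _ := by nlinarith

end CoveringProblem

theorem MirrorDescent.play_pos {U S : Type*} [DecidableEq S] [Fintype S]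
    {P : CoveringProblem U S} {M : ℝ} (O : MirrorDescent P M) (hM : 0 < M) (h : History U S)
    {i : S} (hi : 0 < P.cost i) : 0 < O.play h i := by
  induction h using List.reverseRecOn generalizing i with
  | nil =>
    have : Nonempty S := ⟨i⟩
    exact CoveringProblem.minimizer_pos (c := 1) (G := 0) (q := P.uniformPoint M) hM one_pos
      (O.play_mem _) (fun j hj => div_pos hM (mul_pos (by exact_mod_cast Fintype.card_pos) hj))
      (by simpa using O.play_init) hi
  | append_singleton h x ih =>
    exact CoveringProblem.minimizer_pos hM (by norm_num) (O.play_mem _) (fun j hj => ih hj)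
      (O.play_step h x.1 x.2) hi

/-- Potential function for sums of relative decreases, stopped at level `M`. -/
noncomputable def logPotential (M x : ℝ) : ℝ := if M < x then Real.log (x / M) + 1 else 0

theorem logPotential_nonneg {M : ℝ} (hM : 0 < M) (x : ℝ) : 0 ≤ logPotential M x := by
  unfold logPotential
  split_ifs with h
  · have := Real.log_nonneg ((one_le_div hM).2 h.le)
    linarith
  · exact le_rfl

/-- Above M this is 1 - b/a ≤ log(a/b). A step crossing M has relative decrease at most 1, which the
summand 1 in `logPotential` pays for. -/
theorem logPotential_add_le {M a b : ℝ} (hM : 0 < M) (ha : M < a) (hb : 0 ≤ b) :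
    logPotential M b + 1 / a * (a - b) ≤ logPotential M a := by
  have ha0 : 0 < a := hM.trans ha
  have h1 : 1 / a * (a - b) = 1 - b / a := by field_simp
  rw [h1]
  unfold logPotential
  rw [if_pos ha]
  split_ifs with h
  · have hb0 : 0 < b := hM.trans h
    have h2 := Real.log_le_sub_one_of_pos (div_pos hb0 ha0)
    rw [Real.log_div hb0.ne' ha0.ne'] at h2
    rw [Real.log_div hb0.ne' hM.ne', Real.log_div ha0.ne' hM.ne']
    linarith
  · have h2 := Real.log_nonneg ((one_le_div hM).2 ha.le)
    have h3 : 0 ≤ b / a := by positivity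
    linarith

/-! ### Static gains before the stopping time -/

namespace MonoOCO

variable {U S : Type*} [Fintype U] [DecidableEq U] [Fintype S] [DecidableEq S]
  {P : CoveringProblem U S} {α M : ℝ}

/-- The Lyapunov function that controls the static gains before the stopping time. -/
noncomputable def regretPotential (A : AugScheme P α) (O : MirrorDescent P M) (γ : ℝ)
    (q : S → ℝ) (h : History U S) : ℝ :=
  if M < A.potential h then
    3 / 2 / γ * logPotential M (A.potential h) + 2 * P.divergence M q (O.play h) else 0

variable {A : AugScheme P α} {O : MirrorDescent P M} {γ : ℝ} {q : S → ℝ}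

theorem unstopped_regretPotential_nonneg (hM : 0 < M) (hγ : 0 < γ) (hq : q ∈ P.simplex M)
    (h : History U S) :
    0 ≤ 3 / 2 / γ * logPotential M (A.potential h) + 2 * P.divergence M q (O.play h) := by
  have h1 := logPotential_nonneg hM (A.potential h)
  have h2 := P.divergence_nonneg hM.le (fun i => (hq.1 i).1) (fun i hi => O.play_pos hM h hi)
  positivity

theorem regretPotential_nonneg (hM : 0 < M) (hγ : 0 < γ) (hq : q ∈ P.simplex M)
    (h : History U S) : 0 ≤ regretPotential A O γ q h := by
  unfold regretPotential
  split_ifs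
  · exact unstopped_regretPotential_nonneg hM hγ hq h
  · exact le_rfl

/-- The supergradient inequality at q with weight 1, plus the one at 0 with weight 1/2, gives g q +
g 0 / 2 ≤ (3/2) g p + ⟨G, q⟩ - (3/2)⟨G, p⟩ for the current action p, matching the factor 3/2 of the
mirror step. The value at 0 is kept because only the average of the functions g over the arriving
element is known to be nonnegative. -/
theorem regretPotential_append_le (hα : 1 ≤ α) (hM : 0 < M) (hγ : 0 < γ)
    (hq : q ∈ P.simplex M) {h : History U S} (hh : M < A.potential h) {e : U}
    (he : e ∈ remaining h)
    (hG : ∀ i, 0 ≤ O.grad h e i ∧ O.grad h e i ≤ P.cost i / M)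
    {g : (S → ℝ) → ℝ} (hg : IsSupergradientOn (P.simplex M) g (O.play h) (O.grad h e))
    (W : Finset S) :
    regretPotential A O γ q (h ++ [(e, W)]) ≤ regretPotential A O γ q h +
      (3 / 2 * g (O.play h) - g q - 1 / 2 * g 0) -
      3 / 2 / γ * (1 / A.potential h * ∑ f ∈ remaining h,
        (A.kappa f (A.owned h) - A.kappa f (A.owned (h ++ [(e, W)])))) := by
  -- If this step stops the process the new value is 0, still below the nonnegative unstopped
  -- expression.
  have h1 : regretPotential A O γ q (h ++ [(e, W)]) ≤
      3 / 2 / γ * logPotential M (A.potential (h ++ [(e, W)])) +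
        2 * P.divergence M q (O.play (h ++ [(e, W)])) := by
    rw [regretPotential]
    split_ifs
    · exact le_rfl
    · exact unstopped_regretPotential_nonneg hM hγ hq _
  have h2 := CoveringProblem.mirror_step_inequality (q := O.play h) hM (O.play_mem _)
    (fun i hi => O.play_pos hM h hi) hG (O.play_step h e W) hq
  have h3 := hg q hq
  have h4 := hg 0 (P.zero_mem_simplex hM.le)
  simp only [mul_sub, Finset.sum_sub_distrib, Pi.zero_apply, mul_zero, Finset.sum_const_zero]
    at h3 h4
  have h5 : logPotential M (A.potential (h ++ [(e, W)])) + 1 / A.potential h * ∑ f ∈ remaining h,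
      (A.kappa f (A.owned h) - A.kappa f (A.owned (h ++ [(e, W)]))) ≤
      logPotential M (A.potential h) := by
    refine le_trans ?_ (logPotential_add_le hM hh (A.potential_nonneg hα (h ++ [(e, W)])))
    have h6 : 0 ≤ 1 / A.potential h := by
      have := hM.trans hh
      positivity
    gcongr
    exact A.sum_kappa_sub_le hα h he W
  have h6 := mul_le_mul_of_nonneg_left h5 (show 0 ≤ 3 / 2 / γ by positivity)
  rw [mul_add] at h6
  have h7 : regretPotential A O γ q h = 3 / 2 / γ * logPotential M (A.potential h) +
      2 * P.divergence M q (O.play h) := if_pos hh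
  linarith

theorem expect_staticGainBeforeStop_le (hα : 1 ≤ α) (hopt : P.opt ≤ M) (hM : 0 < M)
    (hγ : 0 < γ) (hq : q ∈ P.simplex M) (gain : History U S → (S → ℝ) → ℝ)
    (gainE : History U S → U → (S → ℝ) → ℝ)
    (hnonneg : ∀ h, Reachable A O h → (remaining h).Nonempty → ∀ p ∈ P.simplex M, 0 ≤ gain h p)
    (hreal : ∀ h, Reachable A O h → 0 < A.potential h →
      γ * gain h (O.play h) ≤ realGain A O h)
    (hmean : ∀ h, Reachable A O h → (remaining h).Nonempty → ∀ p ∈ P.simplex M,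
      gain h p = 1 / ((remaining h).card : ℝ) * ∑ e ∈ remaining h, gainE h e p)
    (hsuper : ∀ h, Reachable A O h → ∀ e ∈ remaining h,
      IsSupergradientOn (P.simplex M) (gainE h e) (O.play h) (O.grad h e))
    (hgrad : ∀ h, Reachable A O h → ∀ e ∈ remaining h, ∀ i,
      0 ≤ O.grad h e i ∧ O.grad h e i ≤ P.cost i / M) :
    expect A O (staticGainBeforeStop A M gain q) ≤ regretPotential A O γ q [] := by
  have h1 : expect A O (staticGainBeforeStop A M gain q) =
      expect A O (fun ω => ∑ t : Fin (Fintype.card U),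
        if M < A.potential (past ω t) then gain (past ω t) q else 0) := by
    refine expect_congr A O fun ω hω => ?_
    unfold staticGainBeforeStop
    refine Finset.sum_congr rfl fun t _ => ?_
    rw [if_congr (lt_stopTime_iff A O hα hopt hM.le hω t) rfl rfl]
  rw [h1]
  refine expect_sum_le A O hα hopt (fun h _ => if M < A.potential h then gain h q else 0)
    (regretPotential A O γ q) (regretPotential_nonneg hM hγ hq) ?_
  intro h hr hne
  have hcard : ((remaining h).card : ℝ) ≠ 0 := by exact_mod_cast hne.card_pos.ne'
  by_cases hp : M < A.potential h
  · simp only [if_pos hp]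
    set V := regretPotential A O γ q h
    set D : U → Finset S → ℝ := fun e W => ∑ f ∈ remaining h,
      (A.kappa f (A.owned h) - A.kappa f (A.owned (h ++ [(e, W)])))
    refine (sum_stepProb_mul_le A O h _ (fun e => (gain h q + V) +
      (3 / 2 * gainE h e (O.play h) - gainE h e q - 1 / 2 * gainE h e 0) -
      3 / 2 / γ * (1 / A.potential h * ∑ W, sampleProb A O h e W * D e W)) ?_).trans ?_
    · intro e he
      calc _ ≤ ∑ W, sampleProb A O h e W * ((gain h q + V) +
            (3 / 2 * gainE h e (O.play h) - gainE h e q - 1 / 2 * gainE h e 0) -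
            3 / 2 / γ * (1 / A.potential h * D e W)) := by
            refine Finset.sum_le_sum fun W _ => mul_le_mul_of_nonneg_left ?_
              (sampleProb_nonneg A O hα hopt h e W)
            linarith [regretPotential_append_le hα hM hγ hq hp he (hgrad h hr e he)
              (hsuper h hr e he) W]
        _ = _ := by
            simp only [mul_sub _ _ (3 / 2 / γ * _), Finset.sum_sub_distrib]
            rw [← Finset.sum_mul, sum_sampleProb, one_mul, Finset.mul_sum, Finset.mul_sum]
            congr 1
            exact Finset.sum_congr rfl fun W _ => by ring
    · have hR : realGain A O h = 1 / ((remaining h).card : ℝ) * (1 / A.potential h *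
          ∑ e ∈ remaining h, ∑ W, sampleProb A O h e W * D e W) := by
        unfold realGain
        rw [mul_assoc]
        congr 2
        refine Finset.sum_congr rfl fun e _ => ?_
        rw [Finset.sum_comm]
        exact Finset.sum_congr rfl fun W _ => (Finset.mul_sum _ _ _).symm
      -- Averaging over the arriving element turns the individual gains into `gain` and the relative
      -- decreases into the real gain.
      have h2 : 1 / ((remaining h).card : ℝ) * ∑ e ∈ remaining h, ((gain h q + V) +
          (3 / 2 * gainE h e (O.play h) - gainE h e q - 1 / 2 * gainE h e 0) -
          3 / 2 / γ * (1 / A.potential h * ∑ W, sampleProb A O h e W * D e W)) =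
          (gain h q + V) + (3 / 2 * gain h (O.play h) - gain h q - 1 / 2 * gain h 0) -
          3 / 2 / γ * realGain A O h := by
        rw [hR, hmean h hr hne _ (O.play_mem h), hmean h hr hne 0 (P.zero_mem_simplex hM.le)]
        simp only [Finset.sum_sub_distrib, Finset.sum_add_distrib, ← Finset.mul_sum,
          Finset.sum_const, nsmul_eq_mul]
        rw [hmean h hr hne q hq]
        field_simp
      rw [h2]
      have h3 := hreal h hr (hM.trans hp)
      have h4 := hnonneg h hr hne 0 (P.zero_mem_simplex hM.le)
      -- The coefficient 3/(2γ) is chosen so that (A1) cancels the term (3/2) gain at the current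
      -- action.
      have h5 := mul_le_mul_of_nonneg_left h3 (show 0 ≤ 3 / 2 / γ by positivity)
      have h6 : 3 / 2 / γ * (γ * gain h (O.play h)) = 3 / 2 * gain h (O.play h) := by
        field_simp
      linarith
  · have h2 : ∀ x : U × Finset S, regretPotential A O γ q (h ++ [x]) = 0 := fun x =>
      if_neg (not_lt.2 ((A.potential_append_le hα h x.1 x.2).trans (not_lt.1 hp)))
    simp only [if_neg hp, h2]
    simp [regretPotential, hp]

theorem regretPotential_nil_le (hα : 1 ≤ α) (hopt : P.opt ≤ M) (hM : 0 < M)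
    (hγ : 0 < γ) (hγ1 : γ ≤ 1) (hq : q ∈ P.simplex M) :
    regretPotential A O γ q [] ≤ 9 * Real.log (Fintype.card S * Fintype.card U) / γ := by
  unfold regretPotential
  split_ifs with hp
  · have hS : Nonempty S := by
      by_contra hS
      rw [not_nonempty_iff] at hS
      linarith [A.potential_le_sum_aug hα, P.sum_aug_le_opt_of_isEmpty]
    have hm : (1 : ℝ) ≤ Fintype.card S := by exact_mod_cast Fintype.card_pos
    have hn : A.potential [] ≤ Fintype.card U * M :=
      (A.potential_le_card_mul_opt hα).trans (by gcongr)
    -- If n ≤ 1, the initial potential would be at most M. Hence log n ≥ log 2, which absorbs the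
    -- additive constants below.
    have hn2 : (2 : ℝ) ≤ Fintype.card U := by
      have : 1 < Fintype.card U := by
        by_contra hc
        have : (Fintype.card U : ℝ) ≤ 1 := by exact_mod_cast not_lt.1 hc
        nlinarith
      exact_mod_cast this
    have h1 : logPotential M (A.potential []) ≤ Real.log (Fintype.card U) + 1 := by
      rw [logPotential, if_pos hp]
      gcongr
      · exact div_pos (hM.trans hp) hM
      · exact (div_le_iff₀ hM).2 hn
    have h2 : P.divergence M q (O.play []) ≤ Real.log (Fintype.card S) + 1 :=
      (CoveringProblem.divergence_le_of_isMinOn hM (O.play_mem _)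
        (fun i hi => div_pos hM (by positivity)) O.play_init hq).trans
        (CoveringProblem.divergence_uniformPoint_le hM hq)
    rw [Real.log_mul (by linarith) (by linarith), le_div_iff₀ hγ, add_mul]
    have h3 := Real.log_le_log two_pos hn2
    have h4 := Real.log_nonneg hm
    have h5 := Real.log_two_gt_d9
    have h6 : 3 / 2 / γ * logPotential M (A.potential []) * γ =
        3 / 2 * logPotential M (A.potential []) := by field_simp
    have h7 := P.divergence_nonneg hM.le (fun i => (hq.1 i).1)
      (fun i hi => O.play_pos hM [] hi)
    -- After multiplication by γ ≤ 1, the sum is at most (3/2)(log n + 1) + 2(log m + 1). Its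
    -- constant 7/2 is below 6 log 2 ≤ 6 log n, so 9 suffices.
    nlinarith
  · exact div_nonneg (mul_nonneg (by norm_num)
      (by exact_mod_cast Real.log_natCast_nonneg (Fintype.card S * Fintype.card U))) hγ.le

end MonoOCO

/-! ### The main bound -/

theorem mainTheorem2 :
    ∃ C : ℝ, 0 < C ∧
      ∀ (U S : Type*) [Fintype U] [DecidableEq U] [Fintype S] [DecidableEq S]
        (P : CoveringProblem U S) (α Est : ℝ), 1 ≤ α → P.opt ≤ Est → Est ≤ 2 * P.opt →
      ∀ (A : AugScheme P α) (O : MirrorDescent P Est)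
        (gain : History U S → (S → ℝ) → ℝ) (gainE : History U S → U → (S → ℝ) → ℝ)
        (γ β δ : ℝ) (pstar : S → ℝ),
        0 < γ → γ ≤ 1 → 0 < β → 0 < δ → pstar ∈ P.simplex Est →
        -- the gain functions are nonnegative
        (∀ h, MonoOCO.Reachable A O h → (remaining h).Nonempty →
          ∀ p ∈ P.simplex Est, 0 ≤ gain h p) →
        -- (A1) lower bound on the real gain
        (∀ h, MonoOCO.Reachable A O h → 0 < A.potential h →
          γ * gain h (O.play h) ≤ MonoOCO.realGain A O h) →
        -- (A2) unbiasedness, and the stochastic gradients are supergradients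
        (∀ h, MonoOCO.Reachable A O h → (remaining h).Nonempty →
          ∀ p ∈ P.simplex Est,
            gain h p = 1 / ((remaining h).card : ℝ) * ∑ e ∈ remaining h, gainE h e p) →
        (∀ h, MonoOCO.Reachable A O h → ∀ e ∈ remaining h,
          IsSupergradientOn (P.simplex Est) (gainE h e) (O.play h) (O.grad h e)) →
        -- (A3) bounded gradients
        (∀ h, MonoOCO.Reachable A O h → ∀ e ∈ remaining h, ∀ i,
          0 ≤ O.grad h e i ∧ O.grad h e i ≤ P.cost i / Est) →
        -- (A4) sufficient static gains
        MonoOCO.expect A O (MonoOCO.costBeforeStop A Est) ≤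
          P.opt * (β * MonoOCO.expect A O (MonoOCO.staticGainBeforeStop A Est gain pstar) + δ) →
        MonoOCO.expect A O (MonoOCO.totalCost A) ≤
          (C * α + C * β * Real.log (Fintype.card S * Fintype.card U) / γ + δ) * P.opt := by

  refine ⟨9, by norm_num, ?_⟩
  intro U S _ _ _ _ P α M hα hopt hM2 A O gain gainE γ β δ q hγ hγ1 hβ hδ hq hnonneg hreal
    hmean hsuper hgrad hcost
  have hopt0 : 0 ≤ P.opt := by linarith
  have hM0 : 0 ≤ M := hopt0.trans hopt
  have h1 := MonoOCO.expect_totalCost_le A O hα hopt hM0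
  have h2 : P.opt * (β * MonoOCO.expect A O (MonoOCO.staticGainBeforeStop A M gain q)) ≤
      P.opt * (β * (9 * Real.log (Fintype.card S * Fintype.card U) / γ)) := by
    -- If c(OPT) = 0, both sides vanish. Otherwise Est > 0, as the divergence argument requires.
    rcases hopt0.eq_or_lt with h0 | h0
    · simp [← h0]
    · have hM : 0 < M := h0.trans_le hopt
      gcongr
      exact (MonoOCO.expect_staticGainBeforeStop_le hα hopt hM hγ hq gain gainE hnonneg hreal
        hmean hsuper hgrad).trans (MonoOCO.regretPotential_nil_le hα hopt hM hγ hγ1 hq)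
  -- Est ≤ 2 c(OPT) already gives the factor 4; the constant 9 is the one chosen for the logarithmic
  -- term.
  have h3 : 2 * α * M ≤ 9 * α * P.opt := by nlinarith [mul_nonneg (by linarith : 0 ≤ α) hopt0]
  calc _ ≤ P.opt * (β * (9 * Real.log (Fintype.card S * Fintype.card U) / γ)) + P.opt * δ +
        9 * α * P.opt := by linarith
    _ = _ := by ring
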